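/- All graphs are finite and may have loops and parallel edges; $V(G)$ and $E(G)$ are the sets of vertices and edges of $G$, and $\Delta G=|E(G)|-|V(G)|$. For $X\subseteq E(G)$, $G\langle X\rangle$ is the subgraph of $G$ formed by the edges in $X$ and their end vertices. A cacti-graph is a graph with no isolated vertices, no leaves (vertices of degree $1$, where a loop adds $2$ to the degree) and no components that are cycles (a loop at one vertex, and two parallel edges on two vertices, are cycles). For an integer $k\ge 1$ let $\mathcal C_k(G)$ be the set of all $C\subseteq E(G)$ such that $G\langle C\rangle$ is a cacti-graph and $\Delta G\langle C\rangle=k$. This is the set of circuits of a matroid on $E(G)$, the $k$-circular matroid $M_k(G)$; let $\rho^*_k(G)$ be its corank, that is, the rank of its dual. For a vertex $x$ let $S(x,G)$ be the set of edges incident to $x$, let $s(x,G)=|S(x,G)|$, and let $\mathcal S(G)=\{S(x,G):x\in V(G)\}$. A graph is $3$-connected if it has at least four vertices and remains connected after the deletion of any set of at most two vertices. Graphs $G$ and $G'$ with $E(G)=E(G')$ are strongly isomorphic if there is a bijection $\nu:V(G)\to V(G')$ such that, for every edge $e$ and all $x,y\in V(G)$, $e$ has ends $x,y$ in $G$ if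 and only if $e$ has ends $\nu(x),\nu(y)$ in $G'$. Theorem. Let $G$ and $G'$ be graphs and let $k\ge 1$. Suppose that $G$ is $3$-connected, $\mathcal C_k(G)\neq\emptyset$, $s(x,G)\le\rho^*_k(G)$ for every vertex $x$ of $G$, $G'$ has no isolated vertices, and $M_k(G')=M_k(G)$. Then $\mathcal S(G)=\mathcal S(G')$, and $G$ and $G'$ are strongly isomorphic. -/

import Mathlib

open scoped Graph

namespace Graph

/-! ### Finite multigraphs (loops and parallel edges allowed) -/

/-- The set of end vertices of the edges in `X`. -/
def ends {α β : Type*} (G : Graph α β) (X : Set β) : Set α :=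
  {v | ∃ e ∈ X, G.Inc e v}

/-- The subgraph `G⟨X⟩` induced by a set `X` of edges: its edges are the edges of `G` in `X`,
its vertices are the end vertices of these edges. -/
def edgeInduce {α β : Type*} (G : Graph α β) (X : Set β) : Graph α β :=
  (G.restrict X).induce (G.ends X)

/-- The vertex star `S(x, G)`: the set of edges of `G` incident to `x`. -/
def vertexStar {α β : Type*} (G : Graph α β) (x : α) : Set β :=
  {e | G.Inc e x}

/-- The set of vertex stars of `G`. -/
def vertexStars {α β : Type*} (G : Graph α β) : Set (Set β) :=
  {S | ∃ x ∈ V(G), G.vertexStar x = S}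

/-- `ΔG = |E(G)| - |V(G)|`, for a finite graph `G`. -/
noncomputable def excess {α β : Type*} (G : Graph α β) : ℤ :=
  (E(G).ncard : ℤ) - (V(G).ncard : ℤ)

/-- The degree of a vertex; a loop contributes two. -/
noncomputable def deg {α β : Type*} (G : Graph α β) (x : α) : ℕ∞ :=
  (G.vertexStar x).encard + {e | G.IsLoopAt e x}.encard

/-- A graph is connected if it has a vertex and any two vertices are joined by a path. -/
def IsConnected {α β : Type*} (G : Graph α β) : Prop :=
  V(G).Nonempty ∧ ∀ x ∈ V(G), ∀ y ∈ V(G), Relation.ReflTransGen G.Adj x y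

/-- `H` is a component of `G`: a connected subgraph closed under adjacency and incidence in `G`. -/
def IsComponentOf {α β : Type*} (H G : Graph α β) : Prop :=
  H.IsClosedSubgraph G ∧ H.IsConnected

/-- A cycle: a finite connected graph in which all vertices have degree two. One vertex with a loop
and two vertices joined by two parallel edges are cycles. -/
def IsCycleGraph {α β : Type*} (G : Graph α β) : Prop :=
  V(G).Finite ∧ G.IsConnected ∧ ∀ x ∈ V(G), G.deg x = 2

/-- A cacti-graph: no isolated vertices, no leaves, no cycle components. -/
structure IsCactiGraph {α β : Type*} (G : Graph α β) : Prop where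
  no_isolated : ∀ x ∈ V(G), G.deg x ≠ 0
  no_leaf : ∀ x ∈ V(G), G.deg x ≠ 1
  no_cycle_component : ∀ H : Graph α β, H.IsComponentOf G → ¬ H.IsCycleGraph

/-- `G` is `n`-connected: it has more than `n` vertices and remains connected after the deletion
of any set of fewer than `n` vertices. -/
def IsNConnected {α β : Type*} (G : Graph α β) (n : ℕ) : Prop :=
  (n : ℕ∞) < V(G).encard ∧
    ∀ X ⊆ V(G), X.encard < (n : ℕ∞) → (G.deleteVerts X).IsConnected

/-- Graphs with the same edge set are strongly isomorphic if some bijection of the vertex sets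
respects the ends of every edge. -/
def StronglyIsomorphic {α α' β : Type*} (G : Graph α β) (G' : Graph α' β) : Prop :=
  E(G) = E(G') ∧ ∃ ν : V(G) ≃ V(G'), ∀ (e : β) (x y : V(G)),
    G.IsLink e x y ↔ G'.IsLink e (ν x) (ν y)

/-- The family `C_k(G)` of `k`-circuits of `G`: the finite edge sets `C` such that `G⟨C⟩` is a
cacti-graph with `ΔG⟨C⟩ = k`. -/
def kCircuits {α β : Type*} (G : Graph α β) (k : ℕ) : Set (Set β) :=
  {C | C ⊆ E(G) ∧ C.Finite ∧ (G.edgeInduce C).excess = k ∧ (G.edgeInduce C).IsCactiGraph}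

/-! ### The `k`-circular matroid -/

theorem ends_finite {α β : Type*} (G : Graph α β) {X : Set β} (hX : X.Finite) :
    (G.ends X).Finite := by
  classical
  have h : G.ends X = ⋃ e ∈ X, {v | G.Inc e v} := by
    ext v; simp [ends]
  rw [h]
  refine hX.biUnion fun e _ ↦ ?_
  by_cases he : e ∈ E(G)
  · obtain ⟨x, y, hxy⟩ := G.exists_isLink_of_mem_edgeSet he
    refine (Set.toFinite {x, y}).subset fun v hv ↦ ?_
    simpa using Inc.eq_or_eq_of_isLink hv hxy
  · refine Set.finite_empty.subset fun v hv ↦ (he (Inc.edge_mem hv)).elim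

theorem ends_mono {α β : Type*} (G : Graph α β) {X Y : Set β} (h : X ⊆ Y) :
    G.ends X ⊆ G.ends Y := fun _ ⟨e, he, hv⟩ ↦ ⟨e, h he, hv⟩

theorem ends_union {α β : Type*} (G : Graph α β) (X Y : Set β) :
    G.ends (X ∪ Y) = G.ends X ∪ G.ends Y := by
  ext v; simp only [ends, Set.mem_union, Set.mem_ofPred_eq]
  constructor
  · rintro ⟨e, he | he, hv⟩
    exacts [.inl ⟨e, he, hv⟩, .inr ⟨e, he, hv⟩]
  · rintro (⟨e, he, hv⟩ | ⟨e, he, hv⟩)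
    exacts [⟨e, .inl he, hv⟩, ⟨e, .inr he, hv⟩]

theorem vertexSet_edgeInduce {α β : Type*} (G : Graph α β) (X : Set β) :
    V(G.edgeInduce X) = G.ends X := rfl

theorem edgeInduce_isLink {α β : Type*} (G : Graph α β) (X : Set β) (e : β) (x y : α) :
    (G.edgeInduce X).IsLink e x y ↔ e ∈ X ∧ G.IsLink e x y := by
  simp only [edgeInduce, induce_isLink, restrict_isLink]
  exact ⟨fun h ↦ h.1, fun h ↦ ⟨h, ⟨e, h.1, h.2.inc_left⟩, ⟨e, h.1, h.2.inc_right⟩⟩⟩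

theorem edgeSet_edgeInduce {α β : Type*} (G : Graph α β) (X : Set β) :
    E(G.edgeInduce X) = E(G) ∩ X := by
  ext e
  rw [edge_mem_iff_exists_isLink, Set.mem_inter_iff, edge_mem_iff_exists_isLink]
  simp only [edgeInduce_isLink]
  grind

theorem edgeInduce_inc {α β : Type*} (G : Graph α β) (X : Set β) (e : β) (x : α) :
    (G.edgeInduce X).Inc e x ↔ e ∈ X ∧ G.Inc e x := by
  simp only [Inc, edgeInduce_isLink]; grind

/-- The number of edge-ends that the edges in `C` have at `v`. -/
noncomputable def degIn {α β : Type*} (G : Graph α β) (C : Finset β) (v : α) : ℕ :=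
  by classical exact (C.filter (G.Inc · v)).card + (C.filter (G.IsLoopAt · v)).card

/-- The number of ends that the edge `e` has in `W`. -/
noncomputable def endsIn {α β : Type*} (G : Graph α β) (W : Finset α) (e : β) : ℕ :=
  by classical exact (W.filter (G.Inc e ·)).card + (W.filter (G.IsLoopAt e ·)).card

theorem sum_degIn {α β : Type*} (G : Graph α β) (C : Finset β) (W : Finset α) :
    ∑ v ∈ W, G.degIn C v = ∑ e ∈ C, G.endsIn W e := by
  classical
  simp only [degIn, endsIn, Finset.sum_add_distrib, Finset.card_filter]
  rw [Finset.sum_comm]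
  congr 1
  rw [Finset.sum_comm]

theorem endsIn_le {α β : Type*} (G : Graph α β) (W : Finset α) (e : β) : G.endsIn W e ≤ 2 := by
  classical
  unfold endsIn
  by_cases he : e ∈ E(G)
  · obtain ⟨x, y, hxy⟩ := G.exists_isLink_of_mem_edgeSet he
    by_cases hne : x = y
    · subst hne
      have h1 : W.filter (G.Inc e ·) ⊆ {x} := fun v hv ↦ by
        simpa using Inc.eq_or_eq_of_isLink (Finset.mem_filter.1 hv).2 hxy
      have h2 : W.filter (G.IsLoopAt e ·) ⊆ {x} := fun v hv ↦ by
        simpa using Inc.eq_or_eq_of_isLink (Finset.mem_filter.1 hv).2.inc hxy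
      have := Finset.card_le_card h1
      have := Finset.card_le_card h2
      simp only [Finset.card_singleton] at *
      omega
    · have h1 : W.filter (G.Inc e ·) ⊆ {x, y} := fun v hv ↦ by
        simpa using Inc.eq_or_eq_of_isLink (Finset.mem_filter.1 hv).2 hxy
      have h2 : W.filter (G.IsLoopAt e ·) = ∅ := by
        refine Finset.filter_eq_empty_iff.2 fun v _ hl ↦ hne ?_
        rw [← hl.eq_of_inc hxy.inc_left, ← hl.eq_of_inc hxy.inc_right]
      have := Finset.card_le_card h1
      rw [Finset.card_pair hne] at this
      simp only [h2, Finset.card_empty]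
      omega
  · have h1 : W.filter (G.Inc e ·) = ∅ :=
      Finset.filter_eq_empty_iff.2 fun v _ hl ↦ he hl.edge_mem
    have h2 : W.filter (G.IsLoopAt e ·) = ∅ :=
      Finset.filter_eq_empty_iff.2 fun v _ hl ↦ he hl.edge_mem
    simp [h1, h2]

theorem endsIn_eq_zero {α β : Type*} (G : Graph α β) (W : Finset α) (e : β)
    (h : ∀ v ∈ W, ¬ G.Inc e v) : G.endsIn W e = 0 := by
  classical
  unfold endsIn
  have h1 : W.filter (G.Inc e ·) = ∅ :=
    Finset.filter_eq_empty_iff.2 fun v hv hl ↦ h v hv hl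
  have h2 : W.filter (G.IsLoopAt e ·) = ∅ :=
    Finset.filter_eq_empty_iff.2 fun v hv hl ↦ h v hv hl.inc
  simp [h1, h2]

theorem endsIn_eq_two_iff {α β : Type*} (G : Graph α β) (W : Finset α) {e : β} (he : e ∈ E(G)) :
    G.endsIn W e = 2 ↔ ∀ v, G.Inc e v → v ∈ W := by
  classical
  unfold endsIn
  obtain ⟨x, y, hxy⟩ := G.exists_isLink_of_mem_edgeSet he
  have hinc : ∀ v, G.Inc e v ↔ v = x ∨ v = y := fun v ↦
    ⟨fun h ↦ h.eq_or_eq_of_isLink hxy,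
      fun h ↦ by rcases h with rfl | rfl; exacts [hxy.inc_left, hxy.inc_right]⟩
  by_cases hne : x = y
  · subst hne
    have hloop : ∀ v, G.IsLoopAt e v ↔ v = x := fun v ↦
      ⟨fun h ↦ h.eq_of_inc hxy.inc_left, fun h ↦ h ▸ hxy⟩
    by_cases h : x ∈ W
    · have h1 : W.filter (G.Inc e ·) = {x} := by
        ext v; simp only [Finset.mem_filter, hinc, Finset.mem_singleton]; grind
      have h2 : W.filter (G.IsLoopAt e ·) = {x} := by
        ext v; simp only [Finset.mem_filter, hloop, Finset.mem_singleton]; grind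
      rw [h1, h2]; simp [hinc, h]
    · have h1 : W.filter (G.Inc e ·) = ∅ := by
        refine Finset.filter_eq_empty_iff.2 fun v hv hl ↦ h ?_
        rcases (hinc v).1 hl with rfl | rfl <;> exact hv
      have h2 : W.filter (G.IsLoopAt e ·) = ∅ :=
        Finset.filter_eq_empty_iff.2 fun v hv hl ↦ h ((hloop v).1 hl ▸ hv)
      rw [h1, h2]; simp [hinc, h]
  · have hloop : ∀ v, ¬ G.IsLoopAt e v := fun v hl ↦ hne <| by
      rw [← hl.eq_of_inc hxy.inc_left, ← hl.eq_of_inc hxy.inc_right]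
    simp only [hloop, Finset.filter_false, Finset.card_empty, add_zero, hinc]
    constructor
    · intro h v hv
      have hsub : W.filter (fun v ↦ v = x ∨ v = y) ⊆ {x, y} := fun v hv ↦ by
        simpa using (Finset.mem_filter.1 hv).2
      have heq := Finset.eq_of_subset_of_card_le hsub (by rw [Finset.card_pair hne, h])
      have : v ∈ ({x, y} : Finset α) := by simpa using hv
      rw [← heq] at this
      exact (Finset.mem_filter.1 this).1
    · intro h
      have : W.filter (fun v ↦ v = x ∨ v = y) = {x, y} := by
        ext v
        simp only [Finset.mem_filter, Finset.mem_insert, Finset.mem_singleton]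
        exact ⟨fun h ↦ h.2, fun hv ↦ ⟨h v hv, hv⟩⟩
      rw [this, Finset.card_pair hne]

theorem deg_edgeInduce {α β : Type*} (G : Graph α β) (C : Finset β) (v : α) :
    (G.edgeInduce C).deg v = G.degIn C v := by
  classical
  unfold deg degIn
  have h1 : (G.edgeInduce C).vertexStar v = (C.filter (G.Inc · v) : Finset β) := by
    ext e; simp [vertexStar, edgeInduce_inc]
  have h2 : {e | (G.edgeInduce C).IsLoopAt e v} = (C.filter (G.IsLoopAt · v) : Finset β) := by
    ext e; simp [← isLink_self_iff, edgeInduce_isLink]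
  rw [h1, h2, Set.encard_coe_eq_coe_finsetCard, Set.encard_coe_eq_coe_finsetCard]
  push_cast
  rfl

theorem excess_edgeInduce {α β : Type*} (G : Graph α β) (C : Finset β) (hC : (C : Set β) ⊆ E(G)) :
    (G.edgeInduce C).excess = (C.card : ℤ) - (G.ends C).ncard := by
  rw [excess, vertexSet_edgeInduce, edgeSet_edgeInduce, Set.inter_eq_right.2 hC,
    Set.ncard_coe_finset]

theorem deg_of_closed {α β : Type*} {G H : Graph α β} (h : H.IsClosedSubgraph G) {v : α}
    (hv : v ∈ V(H)) : H.deg v = G.deg v := by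
  unfold deg
  have h1 : H.vertexStar v = G.vertexStar v := by
    ext e; exact h.inc_congr hv
  have h2 : {e | H.IsLoopAt e v} = {e | G.IsLoopAt e v} := by
    ext e; exact h.isLink_congr hv
  rw [h1, h2]

/-- An edge set of excess at least `k` contains a `k`-circuit. -/
theorem exists_kCircuit_subset {α β : Type*} (G : Graph α β) {k : ℕ} (hk : 1 ≤ k) (C : Finset β)
    (hC : (C : Set β) ⊆ E(G)) (h : (G.ends C).ncard + k ≤ C.card) :
    ∃ D : Finset β, D ⊆ C ∧ (D : Set β) ∈ G.kCircuits k := by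
  classical
  induction hn : C.card using Nat.strong_induction_on generalizing C with
  | _ n ih =>
  by_cases hmin : ∃ D : Finset β, D ⊂ C ∧ (G.ends D).ncard + k ≤ D.card
  · obtain ⟨D, hDC, hD⟩ := hmin
    obtain ⟨D', hD', hD''⟩ := ih D.card (hn ▸ Finset.card_lt_card hDC) D
      (fun e he ↦ hC (hDC.1 he)) hD rfl
    exact ⟨D', hD'.trans hDC.1, hD''⟩
  push Not at hmin
  refine ⟨C, subset_rfl, hC, C.finite_toSet, ?_, ?_⟩
  · rw [excess_edgeInduce G C hC]
    have hne : C.Nonempty := by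
      rw [← Finset.card_pos]; omega
    obtain ⟨e, he⟩ := hne
    have h1 := hmin _ (Finset.erase_ssubset he)
    rw [Finset.card_erase_of_mem he] at h1
    have h2 : (G.ends (C.erase e : Finset β)).ncard ≤ (G.ends C).ncard :=
      Set.ncard_le_ncard (G.ends_mono (by simp)) (G.ends_finite C.finite_toSet)
    omega
  constructor
  · rintro x ⟨e, he, hx⟩ h0
    rw [deg_edgeInduce] at h0
    have h0' : G.degIn C x = 0 := by exact_mod_cast h0
    have h1 : e ∈ C.filter (G.Inc · x) := Finset.mem_filter.2 ⟨by simpa using he, hx⟩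
    have h2 : 0 < (C.filter (G.Inc · x)).card := Finset.card_pos.2 ⟨e, h1⟩
    unfold degIn at h0'
    omega
  · rintro x ⟨e, he, hx⟩ h0
    rw [deg_edgeInduce] at h0
    have h0' : G.degIn C x = 1 := by exact_mod_cast h0
    have he' : e ∈ C := by simpa using he
    have h1 : e ∈ C.filter (G.Inc · x) := Finset.mem_filter.2 ⟨he', hx⟩
    have h2 : 0 < (C.filter (G.Inc · x)).card := Finset.card_pos.2 ⟨e, h1⟩
    unfold degIn at h0'
    have h3 : (C.filter (G.Inc · x)).card = 1 := by omega
    have h4 := hmin _ (Finset.erase_ssubset he')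
    rw [Finset.card_erase_of_mem he'] at h4
    have h5 : G.ends (C.erase e : Finset β) ⊂ G.ends C := by
      refine (G.ends_mono (by simp)).ssubset_of_mem_notMem (a := x) ⟨e, he, hx⟩ ?_
      rintro ⟨f, hf, hfx⟩
      have hf' := Finset.mem_erase.1 (by simpa only [Finset.mem_coe] using hf)
      obtain ⟨g, hg⟩ := Finset.card_eq_one.1 h3
      have := hg ▸ Finset.mem_filter.2 ⟨hf'.2, hfx⟩
      have := hg ▸ h1
      simp_all
    have h6 := Set.ncard_lt_ncard h5 (G.ends_finite C.finite_toSet)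
    have : 0 < C.card := Finset.card_pos.2 ⟨e, he'⟩
    omega
  · rintro H ⟨hcl, -⟩ ⟨hfin, ⟨⟨x, hx⟩, -⟩, hdeg⟩
    set W : Finset α := hfin.toFinset with hW
    set F : Finset β := C.filter (· ∈ E(H)) with hF
    have hWends : (W : Set α) ⊆ G.ends C := by
      rw [hW, Set.Finite.coe_toFinset]
      exact hcl.le.vertexSet_mono
    have hdeg' : ∀ v ∈ W, G.degIn C v = 2 := fun v hv ↦ by
      have hv' : v ∈ V(H) := by simpa [hW] using hv
      have := hdeg v hv'
      rw [deg_of_closed hcl hv', deg_edgeInduce] at this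
      exact_mod_cast this
    have hincF : ∀ e ∈ C, ∀ v ∈ W, G.Inc e v → e ∈ F := fun e he v hv hev ↦ by
      refine Finset.mem_filter.2 ⟨he, hcl.closed (x := v) ?_ (by simpa [hW] using hv)⟩
      rw [edgeInduce_inc]
      exact ⟨by simpa using he, hev⟩
    have hsum := G.sum_degIn C W
    rw [Finset.sum_congr rfl hdeg', Finset.sum_const, smul_eq_mul,
      ← Finset.sum_filter_add_sum_filter_not C (· ∈ E(H))] at hsum
    have hF2 : ∑ e ∈ C with e ∈ E(H), G.endsIn W e = F.card * 2 := by
      rw [← smul_eq_mul, ← Finset.sum_const]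
      refine Finset.sum_congr rfl fun e he ↦ ?_
      obtain ⟨heC, heH⟩ := Finset.mem_filter.1 he
      rw [endsIn_eq_two_iff G W (hC heC)]
      intro v hv
      have hvH : H.Inc e v := by
        rw [hcl.le.inc_congr heH, edgeInduce_inc]
        exact ⟨heC, hv⟩
      simpa [hW] using hvH.vertex_mem
    have hF0 : ∑ e ∈ C with e ∉ E(H), G.endsIn W e = 0 := by
      refine Finset.sum_eq_zero fun e he ↦ G.endsIn_eq_zero W e fun v hv hev ↦ ?_
      obtain ⟨heC, heH⟩ := Finset.mem_filter.1 he
      exact heH (Finset.mem_filter.1 (hincF e heC v hv hev)).2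
    rw [hF2, hF0] at hsum
    have hFW : F.card = W.card := by omega
    have hWpos : 0 < W.card := Finset.card_pos.2 ⟨x, by simpa [hW] using hx⟩
    have hFC : F ⊆ C := Finset.filter_subset _ _
    have hss : C \ F ⊂ C := by
      refine Finset.sdiff_ssubset hFC (Finset.card_pos.1 (by omega))
    have h4 := hmin _ hss
    have h5 : G.ends (C \ F : Finset β) ⊆ G.ends C \ W := by
      rintro v ⟨e, he, hev⟩
      have he' := Finset.mem_sdiff.1 (by simpa only [Finset.mem_coe] using he)
      exact ⟨⟨e, by simpa using he'.1, hev⟩, fun hv ↦ he'.2 (hincF e he'.1 v hv hev)⟩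
    have h6 := Set.ncard_le_ncard h5 ((G.ends_finite C.finite_toSet).sdiff)
    have h7 := Set.ncard_sdiff_add_ncard_of_subset hWends (G.ends_finite C.finite_toSet)
    rw [Set.ncard_coe_finset] at h7
    have h8 := Finset.card_sdiff_add_card_eq_card hFC
    omega

/-- A proper subset of a `k`-circuit has excess less than `k`. -/
theorem kCircuit_ssubset {α β : Type*} (G : Graph α β) {k : ℕ} {C D : Finset β}
    (hC : (C : Set β) ∈ G.kCircuits k) (hDC : D ⊂ C) : D.card < (G.ends D).ncard + k := by
  classical
  obtain ⟨hCE, -, hex, hcac⟩ := hC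
  rw [excess_edgeInduce G C hCE] at hex
  by_contra! hcon
  have hends : G.ends D ⊆ G.ends C := G.ends_mono (by exact_mod_cast hDC.1)
  have hfin : (G.ends C \ G.ends D).Finite := (G.ends_finite C.finite_toSet).sdiff
  set W : Finset α := hfin.toFinset with hW
  have hmemW : ∀ v, v ∈ W ↔ v ∈ G.ends C ∧ v ∉ G.ends D := fun v ↦ by simp [hW]
  have hWcard : W.card + (G.ends D).ncard = (G.ends C).ncard := by
    rw [← Set.ncard_sdiff_add_ncard_of_subset hends (G.ends_finite C.finite_toSet), hW,
      Set.ncard_eq_toFinset_card _ hfin]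
  have hcd := Finset.card_sdiff_add_card_eq_card hDC.1
  have hpos : 0 < (C \ D).card := Finset.card_pos.2 (Finset.sdiff_nonempty.2 hDC.2)
  have hdeg2 : ∀ v ∈ W, 2 ≤ G.degIn C v := fun v hv ↦ by
    have hv' : v ∈ V(G.edgeInduce C) := ((hmemW v).1 hv).1
    have h0 := hcac.no_isolated v hv'
    have h1 := hcac.no_leaf v hv'
    rw [deg_edgeInduce] at h0 h1
    have h0' : G.degIn C v ≠ 0 := by exact_mod_cast h0
    have h1' : G.degIn C v ≠ 1 := by exact_mod_cast h1
    omega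
  have hzero : ∀ e ∈ D, G.endsIn W e = 0 := fun e he ↦
    G.endsIn_eq_zero W e fun v hv hev ↦ ((hmemW v).1 hv).2 ⟨e, by simpa using he, hev⟩
  have hsum := G.sum_degIn C W
  rw [← Finset.sum_sdiff hDC.1, Finset.sum_eq_zero hzero, add_zero] at hsum
  have hlow : W.card * 2 ≤ ∑ v ∈ W, G.degIn C v := by
    rw [← smul_eq_mul]; exact Finset.card_nsmul_le_sum _ _ _ hdeg2
  have hup : ∑ e ∈ C \ D, G.endsIn W e ≤ (C \ D).card * 2 := by
    rw [← smul_eq_mul]; exact Finset.sum_le_card_nsmul _ _ _ fun e _ ↦ G.endsIn_le W e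
  have heq : W.card = (C \ D).card := by omega
  have hdegeq : ∀ v ∈ W, G.degIn C v = 2 := by
    have : ∑ v ∈ W, 2 = ∑ v ∈ W, G.degIn C v := by
      rw [Finset.sum_const, smul_eq_mul]; omega
    exact fun v hv ↦ ((Finset.sum_eq_sum_iff_of_le hdeg2).1 this v hv).symm
  have hendeq : ∀ e ∈ C \ D, G.endsIn W e = 2 := by
    have : ∑ e ∈ C \ D, G.endsIn W e = ∑ e ∈ C \ D, 2 := by
      rw [Finset.sum_const, smul_eq_mul]; omega
    exact (Finset.sum_eq_sum_iff_of_le fun e _ ↦ G.endsIn_le W e).1 this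
  have hstay : ∀ e x y, (G.edgeInduce C).IsLink e x y → x ∈ W → y ∈ W := by
    intro e x y hl hx
    rw [edgeInduce_isLink] at hl
    have heC : e ∈ C := by simpa using hl.1
    have heD : e ∉ D := fun heD ↦ ((hmemW x).1 hx).2 ⟨e, by simpa using heD, hl.2.inc_left⟩
    exact (endsIn_eq_two_iff G W (hCE hl.1)).1 (hendeq e (Finset.mem_sdiff.2 ⟨heC, heD⟩)) y
      hl.2.inc_right
  obtain ⟨w, hw⟩ : W.Nonempty := Finset.card_pos.1 (by omega)
  set K := G.edgeInduce C with hK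
  set X : Set α := {v | Relation.ReflTransGen K.Adj w v} with hX
  have hXW : X ⊆ W := by
    intro v hv
    induction hv with
    | refl => exact hw
    | tail _ hadj ih =>
      obtain ⟨e, he⟩ := hadj
      exact hstay e _ _ he ih
  have hXK : X ⊆ V(K) := fun v hv ↦ ((hmemW v).1 (hXW hv)).1
  have hcl : (K.induce X).IsClosedSubgraph K := by
    refine IsClosedSubgraph.mk' (induce_le hXK) ?_
    rintro e x ⟨y, hxy⟩ hx
    have hx' : x ∈ X := hx
    exact ⟨x, y, hxy, hx', hx'.tail ⟨e, hxy⟩⟩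
  have hreach : ∀ v ∈ X, Relation.ReflTransGen (K.induce X).Adj w v := by
    intro v hv
    induction hv with
    | refl => exact .refl
    | tail hab hadj ih =>
      obtain ⟨e, he⟩ := hadj
      exact ih.tail ⟨e, he, hab, hab.tail ⟨e, he⟩⟩
  have hconn : (K.induce X).IsConnected := by
    refine ⟨⟨w, Relation.ReflTransGen.refl⟩, fun x hx y hy ↦ ?_⟩
    have hsymm : Relation.ReflTransGen (K.induce X).Adj x w :=
      Relation.ReflTransGen.stdSymm.symm _ _ (hreach x hx)
    exact hsymm.trans (hreach y hy)
  refine hcac.no_cycle_component _ ⟨hcl, hconn⟩ ⟨W.finite_toSet.subset hXW, hconn, fun v hv ↦ ?_⟩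
  rw [deg_of_closed hcl hv, deg_edgeInduce, hdegeq v (hXW hv)]
  rfl

/-- `I` is a finite set of edges of `G` that contains no `k`-circuit. -/
def kIndep {α β : Type*} (G : Graph α β) (k : ℕ) (I : Finset β) : Prop :=
  (I : Set β) ⊆ E(G) ∧ ∀ C ∈ G.kCircuits k, ¬ C ⊆ I

theorem kIndep_subset {α β : Type*} (G : Graph α β) (k : ℕ) ⦃I J : Finset β⦄
    (hJ : G.kIndep k J) (hIJ : I ⊆ J) : G.kIndep k I :=
  ⟨(Finset.coe_subset.2 hIJ).trans hJ.1,
    fun C hC hCI ↦ hJ.2 C hC (hCI.trans (Finset.coe_subset.2 hIJ))⟩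

theorem kIndep_iff {α β : Type*} (G : Graph α β) {k : ℕ} (hk : 1 ≤ k) (I : Finset β) :
    G.kIndep k I ↔ (I : Set β) ⊆ E(G) ∧ ∀ J ⊆ I, J.card < (G.ends J).ncard + k := by
  classical
  refine and_congr_right fun hI ↦ ⟨fun h J hJ ↦ ?_, fun h C hC hCI ↦ ?_⟩
  · by_contra! hcon
    obtain ⟨D, hDJ, hD⟩ := G.exists_kCircuit_subset hk J
      (fun e he ↦ hI (hJ (by simpa using he))) hcon
    exact h _ hD (by exact_mod_cast hDJ.trans hJ)
  · obtain ⟨hCE, hfin, hex, -⟩ := hC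
    lift C to Finset β using hfin
    rw [excess_edgeInduce G C hCE] at hex
    have := h C (by exact_mod_cast hCI)
    omega

theorem ends_ncard_submodular {α β : Type*} [DecidableEq β] (G : Graph α β) (S T : Finset β) :
    (G.ends (S ∪ T : Finset β)).ncard + (G.ends (S ∩ T : Finset β)).ncard ≤
      (G.ends S).ncard + (G.ends T).ncard := by
  rw [← Set.ncard_union_add_ncard_inter (G.ends S) (G.ends T) (G.ends_finite S.finite_toSet)
    (G.ends_finite T.finite_toSet), Finset.coe_union, ends_union]
  gcongr
  · exact (G.ends_finite S.finite_toSet).inter_of_left _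
  · exact Set.subset_inter (G.ends_mono (by simp)) (G.ends_mono (by simp))

theorem kIndep_empty {α β : Type*} (G : Graph α β) {k : ℕ} (hk : 1 ≤ k) : G.kIndep k ∅ :=
  (kIndep_iff G hk ∅).2 ⟨by simp, fun J hJ ↦ by
    rw [Finset.subset_empty.1 hJ, Finset.card_empty]; omega⟩

theorem kIndep_aug {α β : Type*} (G : Graph α β) {k : ℕ} (hk : 1 ≤ k) {I J : Finset β}
    [DecidableEq β] (hI : G.kIndep k I) (hJ : G.kIndep k J) (hIJ : I.card < J.card) :
    ∃ e ∈ J, e ∉ I ∧ G.kIndep k (insert e I) := by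
  rw [kIndep_iff G hk] at hI hJ
  simp only [kIndep_iff G hk]
  by_contra! hcon
  have key : ∀ e ∈ J, e ∉ I → ∃ T ⊆ I, (G.ends T).ncard + k = T.card + 1 ∧
      ∀ v, G.Inc e v → v ∈ G.ends T := by
    intro e heJ heI
    have hsub : ((insert e I : Finset β) : Set β) ⊆ E(G) := by
      rw [Finset.coe_insert]
      exact Set.insert_subset (hJ.1 (by simpa using heJ)) hI.1
    obtain ⟨Y, hY, hYc⟩ := hcon e heJ heI hsub
    have heY : e ∈ Y := by
      by_contra heY
      have := hI.2 Y ((Finset.subset_insert_iff_of_notMem heY).1 hY)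
      omega
    have hT : Y.erase e ⊆ I := Finset.subset_insert_iff.1 hY
    have h1 := hI.2 _ hT
    have hle : (G.ends (Y.erase e : Finset β)).ncard ≤ (G.ends Y).ncard :=
      Set.ncard_le_ncard (G.ends_mono (by simp)) (G.ends_finite Y.finite_toSet)
    have hcard := Finset.card_erase_add_one heY
    refine ⟨Y.erase e, hT, by omega, fun v hv ↦ ?_⟩
    have heq : G.ends (Y.erase e : Finset β) = G.ends Y :=
      Set.eq_of_subset_of_ncard_le (G.ends_mono (by simp)) (by omega)
        (G.ends_finite Y.finite_toSet)
    rw [heq]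
    exact ⟨e, by simpa using heY, hv⟩
  have hex : ∃ e ∈ J, e ∉ I := by
    by_contra! h
    have := Finset.card_le_card (show J ⊆ I from h)
    omega
  have hunion : ∀ A : Finset β, A ⊆ J \ I → A.Nonempty → ∃ T ⊆ I,
      (G.ends T).ncard + k = T.card + 1 ∧ ∀ e ∈ A, ∀ v, G.Inc e v → v ∈ G.ends T := by
    intro A hA hne
    induction hne using Finset.Nonempty.cons_induction with
    | singleton a =>
      have ha := Finset.mem_sdiff.1 (hA (Finset.mem_singleton_self a))
      obtain ⟨T, hT, h1, h2⟩ := key a ha.1 ha.2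
      exact ⟨T, hT, h1, by simpa using h2⟩
    | cons a s has hs ih =>
      rw [Finset.cons_eq_insert] at hA
      obtain ⟨S, hS, hS1, hS2⟩ := ih ((Finset.subset_insert _ _).trans hA)
      have ha := Finset.mem_sdiff.1 (hA (Finset.mem_insert_self a s))
      obtain ⟨T, hT, hT1, hT2⟩ := key a ha.1 ha.2
      refine ⟨S ∪ T, Finset.union_subset hS hT, ?_, ?_⟩
      · have h1 := G.ends_ncard_submodular S T
        have h2 := hI.2 _ (Finset.union_subset hS hT)
        have h3 := hI.2 (S ∩ T) (Finset.inter_subset_left.trans hS)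
        have h4 := Finset.card_union_add_card_inter S T
        omega
      · intro e he v hv
        rw [Finset.coe_union, ends_union]
        rcases Finset.mem_cons.1 he with rfl | he
        · exact .inr (hT2 v hv)
        · exact .inl (hS2 e he v hv)
  obtain ⟨e₀, he₀J, he₀I⟩ := hex
  obtain ⟨T, hTI, hT, hTe⟩ := hunion (J \ I) subset_rfl ⟨e₀, Finset.mem_sdiff.2 ⟨he₀J, he₀I⟩⟩
  have h1 := hJ.2 ((J \ I) ∪ (J ∩ T))
    (Finset.union_subset Finset.sdiff_subset Finset.inter_subset_left)
  have h2 : G.ends ((J \ I) ∪ (J ∩ T) : Finset β) ⊆ G.ends T := by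
    rw [Finset.coe_union, ends_union]
    refine Set.union_subset ?_ (G.ends_mono (by simp))
    rintro v ⟨e, he, hv⟩
    exact hTe e (by simpa only [Finset.mem_coe] using he) v hv
  have h3 := Set.ncard_le_ncard h2 (G.ends_finite T.finite_toSet)
  have h4 : J ⊆ ((J \ I) ∪ (J ∩ T)) ∪ (I \ T) := fun e he ↦ by
    simp only [Finset.mem_union, Finset.mem_sdiff, Finset.mem_inter]; tauto
  have h5 := (Finset.card_le_card h4).trans (Finset.card_union_le _ _)
  have h6 := Finset.card_sdiff_add_card_eq_card hTI
  omega

open Classical in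
/-- The `k`-circular matroid `M_k(G)`, for `k ≥ 1`: the matroid on `E(G)` whose circuits are
the members of `C_k(G)`. -/
noncomputable def kCircularMatroid {α β : Type*} (G : Graph α β) (k : ℕ) (hk : 1 ≤ k) :
    Matroid β :=
  (IndepMatroid.ofFinset E(G) (G.kIndep k)
    (kIndep_empty G hk)
    (kIndep_subset G k)
    (fun _ _ hI hJ hIJ ↦ kIndep_aug G hk hI hJ hIJ)
    (fun _ hI ↦ hI.1)).matroid

theorem kCircularMatroid_ground {α β : Type*} (G : Graph α β) (k : ℕ) (hk : 1 ≤ k) :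
    (G.kCircularMatroid k hk).E = E(G) := rfl

theorem kCircularMatroid_indep_iff {α β : Type*} (G : Graph α β) (k : ℕ) (hk : 1 ≤ k)
    (I : Set β) : (G.kCircularMatroid k hk).Indep I ↔
      I ⊆ E(G) ∧ ∀ C ∈ G.kCircuits k, ¬ C ⊆ I := by
  classical
  have h0 : (G.kCircularMatroid k hk).Indep I ↔
      ∀ J : Finset β, (J : Set β) ⊆ I → G.kIndep k J :=
    IndepMatroid.ofFinset_indep' E(G) (G.kIndep k) (kIndep_empty G hk) (kIndep_subset G k)
      (fun _ _ hI hJ hIJ ↦ kIndep_aug G hk hI hJ hIJ) (fun _ hI ↦ hI.1)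
  rw [h0]
  constructor
  · refine fun h ↦ ⟨fun e he ↦ ?_, fun C hC hCI ↦ ?_⟩
    · exact (h {e} (by simpa using he)).1 (by simp)
    · obtain ⟨D, rfl⟩ := hC.2.1.exists_finset_coe
      exact (h D hCI).2 _ hC subset_rfl
  · exact fun h J hJ ↦ ⟨hJ.trans h.1, fun C hC hCJ ↦ h.2 C hC (hCJ.trans hJ)⟩

theorem kCircularMatroid_isCircuit_iff {α β : Type*} (G : Graph α β) (k : ℕ) (hk : 1 ≤ k)
    (C : Set β) : (G.kCircularMatroid k hk).IsCircuit C ↔ C ∈ G.kCircuits k := by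
  classical
  have hanti : ∀ C ∈ G.kCircuits k, ∀ D ∈ G.kCircuits k, D ⊆ C → D = C := by
    intro C hC D hD hDC
    obtain ⟨C, rfl⟩ := hC.2.1.exists_finset_coe
    obtain ⟨D, rfl⟩ := hD.2.1.exists_finset_coe
    by_contra hne
    have h1 := G.kCircuit_ssubset hC
      (Finset.ssubset_iff_subset_ne.2 ⟨by exact_mod_cast hDC, fun h ↦ hne (by rw [h])⟩)
    have h2 := hD.2.2.1
    rw [excess_edgeInduce G D hD.1] at h2
    omega
  rw [Matroid.isCircuit_iff]
  simp only [Matroid.dep_iff, kCircularMatroid_indep_iff, kCircularMatroid_ground]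
  constructor
  · rintro ⟨⟨h, hCE⟩, hmin⟩
    have h' : ∃ D ∈ G.kCircuits k, D ⊆ C := by
      by_contra! hcon
      exact h ⟨hCE, hcon⟩
    obtain ⟨D, hD, hDC⟩ := h'
    rwa [← hmin ⟨fun h ↦ h.2 D hD subset_rfl, hD.1⟩ hDC]
  · refine fun hC ↦ ⟨⟨fun h ↦ h.2 C hC subset_rfl, hC.1⟩, fun D hD hDC ↦ ?_⟩
    have h' : ∃ D' ∈ G.kCircuits k, D' ⊆ D := by
      by_contra! hcon
      exact hD.1 ⟨hD.2, hcon⟩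
    obtain ⟨D', hD', hDD'⟩ := h'
    exact hDC.antisymm (hanti C hC D' hD' (hDD'.trans hDC) ▸ hDD')

end Graph

namespace Graph

/-! ### Ranks of edge sets in the `k`-circular matroid -/

/-! A finite edge set is independent exactly when each subset `J` has at most `|ends J| + k - 1`
edges. Call `J` tight if equality holds. Inside an independent set, tight sets are closed under
union by submodularity of `ends` (`exists_tight_subset`). It follows that a nonempty set `X` without
coloops has rank `|ends X| + k - 1` (`card_add_one_of_isBasis_of_cyclic`). The matroid therefore
knows how many vertices such an `X` covers, and the number is the same in `G` and `G'`.

This is applied to `E(G)` and to `E(G) \ S(x, G)`. The corank bound leaves the latter with one edge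
more than a connected graph on `V(G) \ {x}` needs for full rank
(`ncard_add_le_ncard_compl_vertexStar`), and 3-connectivity keeps it connected after any edge is
removed (`connects_compl_vertexStar`), so it has no coloops. Both graphs thus have the same number
`n` of vertices, and `E(G) \ S(x, G)` covers only `n - 1` of them in `G'`. A vertex `x'` that it
misses has its star inside `S(x, G)`. Conversely, adding an edge of `S(x, G)` to a basis of the
complement gives an independent set too large to fit on `n - 1` vertices, so that edge meets `x'`.

Hence `x ↦ x'` preserves stars. It is injective because distinct vertices of `G` have distinct
stars, and bijective by counting; incidences determine the ends of every edge. -/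

theorem kCircularMatroid_indep_coe_iff {α β : Type*} (G : Graph α β) {k : ℕ} (hk : 1 ≤ k)
    (I : Finset β) : (G.kCircularMatroid k hk).Indep (I : Set β) ↔
      (I : Set β) ⊆ E(G) ∧ ∀ J ⊆ I, J.card < (G.ends J).ncard + k :=
  (kCircularMatroid_indep_iff G k hk I).trans (kIndep_iff G hk I)

/-- If the edges of `A` are spanned by the independent set `I` but lie outside of it, then `I` has
a tight subset covering all ends of edges of `A`. -/
theorem exists_tight_subset {α β : Type*} [DecidableEq β] (G : Graph α β) {k : ℕ} (hk : 1 ≤ k)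
    {I A : Finset β} (hI : (G.kCircularMatroid k hk).Indep (I : Set β)) (hA : A.Nonempty)
    (hAI : Disjoint A I) (hcl : (A : Set β) ⊆ (G.kCircularMatroid k hk).closure I) :
    ∃ T ⊆ I, T.card + 1 = (G.ends T).ncard + k ∧ G.ends A ⊆ G.ends T := by
  have hI' := (kCircularMatroid_indep_coe_iff G hk I).1 hI
  have key : ∀ e ∈ A, ∃ T ⊆ I, T.card + 1 = (G.ends T).ncard + k ∧
      ∀ v, G.Inc e v → v ∈ G.ends T := by
    intro e heA
    have heI : e ∉ I := Finset.disjoint_left.1 hAI heA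
    have hdep := (hI.mem_closure_iff_of_notMem (by simpa using heI)).1 (hcl (by simpa using heA))
    have hsub : ((insert e I : Finset β) : Set β) ⊆ E(G) := by
      rw [Finset.coe_insert]
      exact hdep.subset_ground
    have hnot := hdep.not_indep
    rw [← Finset.coe_insert, kCircularMatroid_indep_coe_iff G hk] at hnot
    push Not at hnot
    -- The violating set `Y` must use `e`. Since `Y.erase e` obeys the bound, it is tight and
    -- deleting `e` loses no vertex.
    obtain ⟨Y, hY, hYc⟩ := hnot hsub
    have heY : e ∈ Y := by
      by_contra heY
      have := hI'.2 Y ((Finset.subset_insert_iff_of_notMem heY).1 hY)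
      omega
    have hT : Y.erase e ⊆ I := Finset.subset_insert_iff.1 hY
    have h1 := hI'.2 _ hT
    have hle : (G.ends (Y.erase e : Finset β)).ncard ≤ (G.ends Y).ncard :=
      Set.ncard_le_ncard (G.ends_mono (by simp)) (G.ends_finite Y.finite_toSet)
    have hcard := Finset.card_erase_add_one heY
    refine ⟨Y.erase e, hT, by omega, fun v hv ↦ ?_⟩
    have heq : G.ends (Y.erase e : Finset β) = G.ends Y :=
      Set.eq_of_subset_of_ncard_le (G.ends_mono (by simp)) (by omega)
        (G.ends_finite Y.finite_toSet)
    rw [heq]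
    exact ⟨e, by simpa using heY, hv⟩
  -- From here only `key` is needed; the cleared facts would otherwise become premises of the
  -- induction hypothesis.
  clear hcl hAI
  induction hA using Finset.Nonempty.cons_induction with
  | singleton a =>
    obtain ⟨T, hT, h1, h2⟩ := key a (Finset.mem_singleton_self a)
    refine ⟨T, hT, h1, ?_⟩
    rintro v ⟨e, he, hv⟩
    obtain rfl : e = a := by simpa using he
    exact h2 v hv
  | cons a s has hs ih =>
    obtain ⟨S, hS, hS1, hS2⟩ := ih fun e he ↦ key e (Finset.mem_cons_of_mem he)
    obtain ⟨T, hT, hT1, hT2⟩ := key a (Finset.mem_cons_self a s)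
    refine ⟨S ∪ T, Finset.union_subset hS hT, ?_, ?_⟩
    -- Submodularity against the bounds for `S ∪ T` and `S ∩ T` forces equality in both. An empty
    -- intersection is no exception, since `1 ≤ k`.
    · have h1 := G.ends_ncard_submodular S T
      have h2 := hI'.2 _ (Finset.union_subset hS hT)
      have h3 := hI'.2 (S ∩ T) (Finset.inter_subset_left.trans hS)
      have h4 := Finset.card_union_add_card_inter S T
      omega
    · rw [Finset.coe_union, ends_union]
      rintro v ⟨e, he, hv⟩
      rcases Finset.mem_cons.1 (Finset.mem_coe.1 he) with rfl | he
      · exact .inr (hT2 v hv)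
      · exact .inl (hS2 ⟨e, by simpa using he, hv⟩)

theorem ends_nonempty {α β : Type*} (G : Graph α β) {X : Set β} (hX : X ⊆ E(G))
    (hne : X.Nonempty) : (G.ends X).Nonempty := by
  obtain ⟨e, he⟩ := hne
  obtain ⟨x, y, hxy⟩ := G.exists_isLink_of_mem_edgeSet (hX he)
  exact ⟨x, e, he, hxy.inc_left⟩

/-- A nonempty set of edges without coloops has rank `|V| + k - 1`. -/
theorem card_add_one_of_isBasis_of_cyclic {α β : Type*} (G : Graph α β) {k : ℕ} (hk : 1 ≤ k)
    {I X : Finset β} (hI : (G.kCircularMatroid k hk).IsBasis (I : Set β) X) (hne : X.Nonempty)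
    (hX : ∀ f ∈ X, f ∈ (G.kCircularMatroid k hk).closure ((X : Set β) \ {f})) :
    I.card + 1 = (G.ends X).ncard + k := by
  classical
  set M := G.kCircularMatroid k hk with hMdef
  have hIX : I ⊆ X := by exact_mod_cast hI.subset
  -- If `X` were independent, each of its elements would be a coloop.
  have hA : (X \ I).Nonempty := by
    rw [Finset.sdiff_nonempty]
    intro hXI
    obtain ⟨f, hf⟩ := hne
    obtain rfl : X = I := hXI.antisymm hIX
    exact hI.indep.notMem_closure_sdiff_of_mem (by simpa using hf) (hX f hf)
  have hcl : ((X \ I : Finset β) : Set β) ⊆ M.closure I :=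
    fun e he ↦ hI.subset_closure (by simp at he; simpa using he.1)
  obtain ⟨T, hTI, hT, hTe⟩ := G.exists_tight_subset hk hI.indep hA Finset.sdiff_disjoint hcl
  have hTind := (kCircularMatroid_indep_coe_iff G hk T).1
    (hI.indep.subset (by exact_mod_cast hTI))
  -- A tight set spans every edge with all ends among its own: adding one raises the size but not
  -- the bound.
  have hclT : ((X \ I : Finset β) : Set β) ⊆ M.closure T := by
    intro e he
    have he' : e ∈ X ∧ e ∉ I := by simpa using he
    have heT : e ∉ T := fun h ↦ he'.2 (hTI h)
    have hTi : M.Indep (T : Set β) := hI.indep.subset (by exact_mod_cast hTI)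
    rw [hTi.mem_closure_iff_of_notMem (by simpa using heT), ← Finset.coe_insert,
      ← M.not_indep_iff (by
        rw [Finset.coe_insert]
        exact Set.insert_subset (hI.subset_ground (by simpa using he'.1)) hTi.subset_ground)]
    rw [hMdef, kCircularMatroid_indep_coe_iff]
    rintro ⟨-, h⟩
    have h1 := h _ subset_rfl
    rw [Finset.card_insert_of_notMem heT] at h1
    have h2 : G.ends (insert e T : Finset β) = G.ends T := by
      refine (G.ends_mono (by simp)).antisymm' ?_
      rw [Finset.coe_insert]
      rintro v ⟨g, rfl | hg, hv⟩
      · exact hTe ⟨g, he, hv⟩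
      · exact ⟨g, hg, hv⟩
    rw [h2] at h1
    omega
  -- For `f ∈ I \ T`, the set `I \ {f}` contains `T`, so it spans `X \ {f}`. As `f` is not a coloop,
  -- it spans `f` too, contradicting independence of `I`.
  obtain rfl : T = I := by
    refine hTI.antisymm fun f hf ↦ ?_
    by_contra hfT
    refine hI.indep.notMem_closure_sdiff_of_mem (by simpa using hf) ?_
    refine M.closure_subset_closure_of_subset_closure ?_ (hX f (hIX hf))
    rintro g ⟨hgX, hgf⟩
    by_cases hgI : g ∈ I
    · exact M.mem_closure_of_mem' ⟨by simpa using hgI, hgf⟩ (hI.subset_ground hgX)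
    · refine M.closure_subset_closure ?_ (hclT (by simpa using ⟨hgX, hgI⟩))
      exact fun t ht ↦ ⟨hTI ht, fun h ↦ hfT (h ▸ ht)⟩
  have : G.ends X = G.ends T := by
    refine (G.ends_mono (by exact_mod_cast hIX)).antisymm' ?_
    rintro v ⟨e, he, hv⟩
    by_cases heT : e ∈ T
    · exact ⟨e, heT, hv⟩
    · exact hTe ⟨e, by simpa using ⟨he, heT⟩, hv⟩
  rw [this, hT]

/-- The edge set `X` connects the vertex set `U`: its ends lie in `U`, and it has an edge in every
cut of `U`. -/
def Connects {α β : Type*} (G : Graph α β) (X : Set β) (U : Set α) : Prop :=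
  G.ends X ⊆ U ∧ ∀ W ⊆ U, W.Nonempty → W ≠ U → ∃ e ∈ X, ∃ a ∈ W, ∃ b ∈ U \ W, G.IsLink e a b

/-- Grow `W` to `U` one vertex at a time. The edge of `X` used to reach the new vertex then has both
ends inside, so each step removes at least one edge from the set counted on the right. -/
theorem Connects.ncard_sdiff_le {α β : Type*} {G : Graph α β} {X : Set β} {U : Set α}
    (h : G.Connects X U) (hX : X.Finite) (hU : U.Finite) {W : Set α} (hWU : W ⊆ U)
    (hW : W.Nonempty) : (U \ W).ncard ≤ {e ∈ X | ∃ v, G.Inc e v ∧ v ∉ W}.ncard := by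
  induction hn : (U \ W).ncard generalizing W with
  | zero => simp
  | succ n ih =>
    have hne : W ≠ U := by rintro rfl; simp at hn
    obtain ⟨e, heX, a, ha, b, hb, hab⟩ := h.2 W hWU hW hne
    have h1 : (U \ insert b W).ncard = n := by
      have : U \ insert b W = (U \ W) \ {b} := by ext; simp; tauto
      rw [this, Set.ncard_sdiff_singleton_of_mem hb, hn]; rfl
    have h2 := ih (Set.insert_subset hb.1 hWU) (Set.insert_nonempty _ _) h1
    have h3 : {e ∈ X | ∃ v, G.Inc e v ∧ v ∉ insert b W} ⊂ {e ∈ X | ∃ v, G.Inc e v ∧ v ∉ W} := by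
      refine Set.ssubset_iff_exists.2 ⟨?_, e, ⟨heX, b, hab.inc_right, hb.2⟩, ?_⟩
      · rintro f ⟨hf, v, hv, hvW⟩
        exact ⟨hf, v, hv, fun h ↦ hvW (.inr h)⟩
      · rintro ⟨-, v, hv, hvW⟩
        rcases hv.eq_or_eq_of_isLink hab with rfl | rfl
        · exact hvW (.inr ha)
        · exact hvW (.inl rfl)
    have h4 := Set.ncard_lt_ncard h3 (hX.subset (Set.sep_subset _ _))
    omega

/-- The cut around `{u}` supplies an edge at `u`; nontriviality of `U` makes this a genuine cut. -/
theorem Connects.ends_eq {α β : Type*} {G : Graph α β} {X : Set β} {U : Set α}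
    (h : G.Connects X U) (hU : U.Nontrivial) : G.ends X = U := by
  refine h.1.antisymm fun u hu ↦ ?_
  have hne : ({u} : Set α) ≠ U := by rintro rfl; simp at hU
  obtain ⟨e, he, a, rfl, b, -, hab⟩ := h.2 {u} (by simpa using hu) (by simp) hne
  exact ⟨e, he, hab.inc_left⟩

theorem Connects.mono {α β : Type*} {G : Graph α β} {X Y : Set β} {U : Set α}
    (h : G.Connects X U) (hXY : X ⊆ Y) (hY : G.ends Y ⊆ U) : G.Connects Y U :=
  ⟨hY, fun W hW hne hWU ↦ by
    obtain ⟨e, he, h'⟩ := h.2 W hW hne hWU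
    exact ⟨e, hXY he, h'⟩⟩

/-- A connected graph with sufficiently many edges has rank `|V| + k - 1`. -/
theorem Connects.card_add_one_of_isBasis {α β : Type*} {G : Graph α β} {k : ℕ} (hk : 1 ≤ k)
    {I X : Finset β} {U : Set α} (h : G.Connects X U) (hU : U.Finite)
    (hcard : U.ncard + k ≤ X.card + 1)
    (hI : (G.kCircularMatroid k hk).IsBasis (I : Set β) X) :
    I.card + 1 = U.ncard + k := by
  classical
  have hIX : I ⊆ X := by exact_mod_cast hI.subset
  have hle := ((kCircularMatroid_indep_coe_iff G hk I).1 hI.indep).2 I subset_rfl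
  have hends : (G.ends I).ncard ≤ U.ncard :=
    Set.ncard_le_ncard ((G.ends_mono (by exact_mod_cast hIX)).trans h.1) hU
  by_cases hXI : X ⊆ I
  · have := Finset.card_le_card hXI
    omega
  have hcl : ((X \ I : Finset β) : Set β) ⊆ (G.kCircularMatroid k hk).closure I :=
    fun e he ↦ hI.subset_closure (by simp at he; simpa using he.1)
  have hA : (X \ I).Nonempty := Finset.sdiff_nonempty.2 hXI
  obtain ⟨T, hTI, hT, hTe⟩ := G.exists_tight_subset hk hI.indep hA Finset.sdiff_disjoint hcl
  have hTU : G.ends T ⊆ U := (G.ends_mono (by exact_mod_cast hTI.trans hIX)).trans h.1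
  have hne : (G.ends T).Nonempty := (G.ends_nonempty
    (fun e he ↦ hI.subset_ground (by simp at he; simpa using he.1)) (Finset.coe_nonempty.2 hA)).mono hTe
  have h1 := h.ncard_sdiff_le X.finite_toSet hU hTU hne
  -- All of `X \ I` lives on the ends of the tight set `T`, so edges leaving these ends lie in `I \
  -- T`. By `h1` there are at least `|U \ ends T|` of them, which lifts `|T|` to the full rank.
  have h2 : {e ∈ (X : Set β) | ∃ v, G.Inc e v ∧ v ∉ G.ends T} ⊆ (I \ T : Finset β) := by
    rintro e ⟨he, v, hv, hvT⟩
    rw [Finset.mem_coe, Finset.mem_sdiff]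
    refine ⟨?_, fun heT ↦ hvT ⟨e, heT, hv⟩⟩
    by_contra heI
    exact hvT (hTe ⟨e, by simpa using ⟨he, heI⟩, hv⟩)
  have h3 := Set.ncard_le_ncard h2 (Finset.finite_toSet _)
  rw [Set.ncard_coe_finset] at h3
  have h4 := Finset.card_sdiff_add_card_eq_card hTI
  have h5 := Set.ncard_sdiff_add_ncard_of_subset hTU hU
  omega

end Graph

namespace Graph

/-! ### Connectivity -/

theorem encard_pair_le_two {α : Type*} (a b : α) : ({a, b} : Set α).encard ≤ 2 := by
  refine (Set.encard_insert_le _ _).trans ?_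
  rw [Set.encard_singleton]
  norm_num

theorem IsConnected.exists_isLink_of_cut {α β : Type*} {K : Graph α β} (h : K.IsConnected)
    {W : Set α} {p q : α} (hp : p ∈ V(K)) (hpW : p ∈ W) (hq : q ∈ V(K)) (hqW : q ∉ W) :
    ∃ e a b, K.IsLink e a b ∧ a ∈ W ∧ b ∉ W := by
  by_contra! hcon
  refine hqW ?_
  have hpq := h.2 p hp q hq
  induction hpq with
  | refl => exact hpW
  | tail _ hadj ih =>
    obtain ⟨e, he⟩ := hadj
    exact hcon e _ _ he (by_contra fun hb ↦ hb (ih he.left_mem hb))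

theorem IsNConnected.exists_isLink_of_cut {α β : Type*} {G : Graph α β} {n : ℕ}
    (h : G.IsNConnected n) {X W : Set α} (hX : X ⊆ V(G)) (hXn : X.encard < n) {p q : α}
    (hp : p ∈ V(G)) (hpX : p ∉ X) (hpW : p ∈ W) (hq : q ∈ V(G)) (hqX : q ∉ X) (hqW : q ∉ W) :
    ∃ e, ∃ a ∈ W, ∃ b ∈ V(G) \ W, G.IsLink e a b ∧ a ∉ X ∧ b ∉ X := by
  obtain ⟨e, a, b, hab, ha, hb⟩ := (h.2 X hX hXn).exists_isLink_of_cut (W := W) (p := p) (q := q)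
    (by simp [hp, hpX]) hpW (by simp [hq, hqX]) hqW
  rw [deleteVerts_isLink] at hab
  exact ⟨e, a, ha, b, ⟨hab.1.right_mem, hb⟩, hab.1, hab.2.1, hab.2.2⟩

theorem IsNConnected.exists_notMem {α β : Type*} {G : Graph α β} {n : ℕ}
    (h : G.IsNConnected n) {X : Set α} (hX : X.encard ≤ n) : ∃ v ∈ V(G), v ∉ X := by
  by_contra! hcon
  exact absurd ((Set.encard_le_encard hcon).trans hX) h.1.not_ge

theorem ends_subset_vertexSet {α β : Type*} (G : Graph α β) (X : Set β) : G.ends X ⊆ V(G) := by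
  rintro v ⟨e, -, hv⟩
  exact hv.vertex_mem

theorem IsNConnected.connects_edgeSet {α β : Type*} {G : Graph α β} (h : G.IsNConnected 3) :
    G.Connects E(G) V(G) := by
  refine ⟨G.ends_subset_vertexSet _, fun W hWV ⟨p, hp⟩ hne ↦ ?_⟩
  obtain ⟨q, hq, hqW⟩ := Set.exists_of_ssubset (hWV.ssubset_of_ne hne)
  obtain ⟨e, a, ha, b, hb, hab, -⟩ := h.exists_isLink_of_cut (X := ∅) (W := W) (by simp)
    (by simp) (hWV hp) (by simp) hp hq (by simp) hqW
  exact ⟨e, hab.edge_mem, a, ha, b, hb, hab⟩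

/-- In a `3`-connected graph, deleting a vertex and an edge leaves a connected graph. -/
theorem IsNConnected.connects_compl_vertexStar {α β : Type*} {G : Graph α β}
    (h : G.IsNConnected 3) {x : α} (hx : x ∈ V(G)) {f : β} (hf : f ∈ E(G) \ G.vertexStar x) :
    G.Connects ((E(G) \ G.vertexStar x) \ {f}) (V(G) \ {x}) := by
  obtain ⟨a, b, hab⟩ := G.exists_isLink_of_mem_edgeSet hf.1
  have hax : a ≠ x := by rintro rfl; exact hf.2 hab.inc_left
  have hbx : b ≠ x := by rintro rfl; exact hf.2 hab.inc_right
  refine ⟨?_, fun W hWU hW hne ↦ ?_⟩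
  · rintro v ⟨e, he, hv⟩
    exact ⟨hv.vertex_mem, by rintro rfl; exact he.1.2 hv⟩
  obtain ⟨p₀, hp₀⟩ := hW
  obtain ⟨q₀, hq₀, hq₀W⟩ := Set.exists_of_ssubset (hWU.ssubset_of_ne hne)
  obtain ⟨e, s, hs, t, ht, hst, hsx, htx, hef⟩ : ∃ e, ∃ s ∈ W, ∃ t ∈ V(G) \ W,
      G.IsLink e s t ∧ s ≠ x ∧ t ≠ x ∧ e ≠ f := by
    -- Deleting `x` and an end `c` of `f` also kills `f`, so a surviving crossing edge is not `f`.
    -- This needs a vertex other than `c` on both sides of the cut.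
    have key : ∀ c ∈ V(G), G.Inc f c → ∀ p ∈ W, p ≠ c → ∀ q ∈ V(G) \ {x}, q ∉ W → q ≠ c →
        ∃ e, ∃ s ∈ W, ∃ t ∈ V(G) \ W, G.IsLink e s t ∧ s ≠ x ∧ t ≠ x ∧ e ≠ f := by
      intro c hcV hc p hp hpc q hq hqW hqc
      obtain ⟨e, s, hs, t, ht, hst, hsX, htX⟩ := h.exists_isLink_of_cut (X := {x, c}) (W := W)
        (by rintro v (rfl | rfl) <;> assumption)
        ((encard_pair_le_two _ _).trans_lt (by norm_num)) (hWU hp).1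
        (by simpa [hpc] using (hWU hp).2) hp hq.1 (by simpa [hqc] using hq.2) hqW
      refine ⟨e, s, hs, t, ht, hst, fun h ↦ hsX (.inl h), fun h ↦ htX (.inl h), ?_⟩
      rintro rfl
      rcases hc.eq_or_eq_of_isLink hst with rfl | rfl
      exacts [hsX (.inr rfl), htX (.inr rfl)]
    by_cases hA : (∃ p ∈ W, p ≠ a) ∧ ∃ q ∈ V(G) \ {x}, q ∉ W ∧ q ≠ a
    · obtain ⟨⟨p, hp, hpa⟩, q, hq, hqW, hqa⟩ := hA
      exact key a hab.left_mem hab.inc_left p hp hpa q hq hqW hqa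
    by_cases hB : (∃ p ∈ W, p ≠ b) ∧ ∃ q ∈ V(G) \ {x}, q ∉ W ∧ q ≠ b
    · obtain ⟨⟨p, hp, hpa⟩, q, hq, hqW, hqa⟩ := hB
      exact key b hab.right_mem hab.inc_right p hp hpa q hq hqW hqa
    -- Otherwise a fourth vertex `c` lies on one side, and the failure of `key` at both ends makes
    -- the other side equal to `{a}` and to `{b}`. A loop crosses no cut, so deleting `x` alone then
    -- suffices.
    have hloop : a = b := by
      by_contra hne
      obtain ⟨c, hc, hcX⟩ := h.exists_notMem (X := {x, a, b}) (by
        refine (Set.encard_insert_le _ _).trans ?_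
        exact (add_le_add_left (encard_pair_le_two a b) 1).trans (by norm_num))
      simp only [Set.mem_insert_iff, Set.mem_singleton_iff, not_or] at hcX
      by_cases hcW : c ∈ W
      · have h1 : q₀ = a := by by_contra hq; exact hA ⟨⟨c, hcW, hcX.2.1⟩, q₀, hq₀, hq₀W, hq⟩
        have h2 : q₀ = b := by by_contra hq; exact hB ⟨⟨c, hcW, hcX.2.2⟩, q₀, hq₀, hq₀W, hq⟩
        exact hne (h1.symm.trans h2)
      · have h1 : p₀ = a := by
          by_contra hp; exact hA ⟨⟨p₀, hp₀, hp⟩, c, ⟨hc, hcX.1⟩, hcW, hcX.2.1⟩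
        have h2 : p₀ = b := by
          by_contra hp; exact hB ⟨⟨p₀, hp₀, hp⟩, c, ⟨hc, hcX.1⟩, hcW, hcX.2.2⟩
        exact hne (h1.symm.trans h2)
    obtain ⟨e, s, hs, t, ht, hst, hsX, htX⟩ := h.exists_isLink_of_cut (X := {x}) (W := W)
      (by simpa using hx) (by rw [Set.encard_singleton]; norm_num) (hWU hp₀).1 (hWU hp₀).2 hp₀
      hq₀.1 hq₀.2 hq₀W
    refine ⟨e, s, hs, t, ht, hst, hsX, htX, ?_⟩
    rintro rfl
    subst hloop
    obtain ⟨rfl, rfl⟩ | ⟨rfl, rfl⟩ := hst.eq_and_eq_or_eq_and_eq hab <;> exact ht.2 hs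
  refine ⟨e, ⟨⟨hst.edge_mem, fun hex ↦ ?_⟩, hef⟩, s, hs, t, ⟨⟨ht.1, htx⟩, ht.2⟩, hst⟩
  rcases Inc.eq_or_eq_of_isLink hex hst with rfl | rfl
  exacts [hsx rfl, htx rfl]

/-- An edge links `x` and `y` exactly when both are incident to it and no other vertex is, so
incidence alone determines the ends. -/
theorem stronglyIsomorphic_of_vertexStar {α α' β : Type*} {G : Graph α β} {G' : Graph α' β}
    (hE : E(G) = E(G')) (ν : V(G) ≃ V(G')) (hν : ∀ x, G'.vertexStar (ν x) = G.vertexStar x) :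
    G.StronglyIsomorphic G' := by
  have hinc : ∀ e (x : V(G)), G.Inc e x ↔ G'.Inc e (ν x) :=
    fun e x ↦ (Set.ext_iff.1 (hν x) e).symm
  refine ⟨hE, ν, fun e x y ↦ ?_⟩
  rw [isLink_iff_inc, isLink_iff_inc, hinc, hinc]
  refine and_congr_right fun _ ↦ and_congr_right fun _ ↦ ⟨fun h z hz ↦ ?_, fun h z hz ↦ ?_⟩
  · obtain ⟨w, hw⟩ := ν.surjective ⟨z, hz.vertex_mem⟩
    have hzw : z = ν w := by rw [hw]
    subst hzw
    rcases h w ((hinc e w).2 hz) with h | h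
    · exact .inl (by rw [Subtype.ext h])
    · exact .inr (by rw [Subtype.ext h])
  · rcases h (ν ⟨z, hz.vertex_mem⟩) ((hinc e ⟨z, hz.vertex_mem⟩).1 hz) with h | h
    · exact .inl (by rw [← ν.injective (Subtype.ext h)])
    · exact .inr (by rw [← ν.injective (Subtype.ext h)])

end Graph

namespace Graph

/-! ### Vertex stars of 3-connected graphs -/

/-- Edges of a connected graph that stays connected after the deletion of any edge are not coloops
of the `k`-circular matroid, if there are sufficiently many edges. -/
theorem mem_closure_of_connects {α β : Type*} {G : Graph α β} {k : ℕ} (hk : 1 ≤ k)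
    {X : Finset β} {U : Set α} (hX : (X : Set β) ⊆ E(G)) (hU : U.Finite)
    (hXU : G.ends X ⊆ U) (hcard : U.ncard + k ≤ X.card) {f : β} (hf : f ∈ X)
    (h : G.Connects ((X : Set β) \ {f}) U) :
    f ∈ (G.kCircularMatroid k hk).closure ((X : Set β) \ {f}) := by
  classical
  set M := G.kCircularMatroid k hk with hM
  rw [← Finset.coe_erase] at h ⊢
  have hsub : ((X.erase f : Finset β) : Set β) ⊆ E(G) :=
    (Finset.coe_subset.2 (Finset.erase_subset _ _)).trans hX
  obtain ⟨I, hI⟩ := M.exists_isBasis (X.erase f : Finset β) hsub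
  obtain ⟨I, rfl⟩ := ((X.erase f).finite_toSet.subset hI.subset).exists_finset_coe
  have hIX : I ⊆ X.erase f := by exact_mod_cast hI.subset
  have hfI : f ∉ I := fun h ↦ Finset.notMem_erase f X (hIX h)
  -- After the loss of `f`, exactly the number of edges required for full rank is still guaranteed.
  have h1 := h.card_add_one_of_isBasis hk hU
    (by have := Finset.card_erase_add_one hf; omega) hI
  refine M.closure_subset_closure hI.subset ?_
  by_contra hfcl
  have hind := (hI.indep.notMem_closure_iff_of_notMem (by simpa using hfI)
    (hX (by simpa using hf))).1 hfcl
  rw [← Finset.coe_insert, hM, kCircularMatroid_indep_coe_iff] at hind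
  have h2 := hind.2 _ subset_rfl
  rw [Finset.card_insert_of_notMem hfI] at h2
  -- An independent `insert f I` would have `|U| + k` edges on at most `|U|` vertices.
  have h3 : (G.ends (insert f I : Finset β)).ncard ≤ U.ncard := by
    refine Set.ncard_le_ncard ((G.ends_mono ?_).trans hXU) hU
    exact_mod_cast Finset.insert_subset hf (hIX.trans (Finset.erase_subset _ _))
  omega

/-- Adding an edge with an end outside of the ends of an independent set preserves independence. -/
theorem indep_insert_of_inc {α β : Type*} [DecidableEq β] {G : Graph α β} {k : ℕ} (hk : 1 ≤ k)
    {I : Finset β} (hI : (G.kCircularMatroid k hk).Indep (I : Set β)) {e : β} {x : α}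
    (hx : G.Inc e x) (hxI : x ∉ G.ends I) :
    (G.kCircularMatroid k hk).Indep ((insert e I : Finset β) : Set β) := by
  rw [kCircularMatroid_indep_coe_iff] at hI ⊢
  refine ⟨by rw [Finset.coe_insert]; exact Set.insert_subset hx.edge_mem hI.1, fun J hJ ↦ ?_⟩
  by_cases heJ : e ∈ J
  · have hJI : J.erase e ⊆ I := Finset.subset_insert_iff.1 hJ
    have h1 := hI.2 _ hJI
    have h2 := Finset.card_erase_add_one heJ
    -- The new vertex `x` raises the bound by at least the one edge added.
    have h3 : G.ends (J.erase e : Finset β) ⊂ G.ends J := by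
      refine (G.ends_mono (by simp)).ssubset_of_mem_notMem (a := x) ⟨e, heJ, hx⟩ fun h ↦ hxI ?_
      exact G.ends_mono (by exact_mod_cast hJI) h
    have h4 := Set.ncard_lt_ncard h3 (G.ends_finite J.finite_toSet)
    omega
  · exact hI.2 J ((Finset.subset_insert_iff_of_notMem heJ).1 hJ)

/-- If all vertex stars of the 3-connected graph `G` have size at most the corank, then every
vertex-deleted subgraph has at least `k` more edges than vertices. -/
theorem ncard_add_le_ncard_compl_vertexStar {α β : Type*} {G : Graph α β} (hV : V(G).Finite)
    (hE : E(G).Finite) {k : ℕ} (hk : 1 ≤ k) (h3 : G.IsNConnected 3)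
    (hC : (G.kCircuits k).Nonempty) {x : α} (hx : x ∈ V(G))
    (hs : (G.vertexStar x).encard ≤ (G.kCircularMatroid k hk)✶.eRank) :
    (V(G) \ {x}).ncard + k ≤ (E(G) \ G.vertexStar x).ncard := by
  classical
  obtain ⟨C, hC⟩ := hC
  obtain ⟨C, rfl⟩ := hC.2.1.exists_finset_coe
  have hex := hC.2.2.1
  rw [excess_edgeInduce G C hC.1] at hex
  have hCne : C.Nonempty := by rw [← Finset.card_pos]; omega
  have hCV := G.ends_subset_vertexSet C
  -- A `k`-circuit has `k` more edges than vertices, and connectivity adds an edge for each vertex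
  -- outside it; hence `|E| ≥ |V| + k`.
  have h1 := h3.connects_edgeSet.ncard_sdiff_le hE hV hCV (G.ends_nonempty hC.1 hCne)
  have h2 : {e ∈ E(G) | ∃ v, G.Inc e v ∧ v ∉ G.ends C} ⊆ E(G) \ C :=
    fun e ⟨he, v, hv, hvC⟩ ↦ ⟨he, fun heC ↦ hvC ⟨e, heC, hv⟩⟩
  have h3' := Set.ncard_le_ncard h2 hE.sdiff
  have h4 := Set.ncard_sdiff_add_ncard_of_subset hC.1 hE
  have h5 := Set.ncard_sdiff_add_ncard_of_subset hCV hV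
  rw [Set.ncard_coe_finset] at h4
  obtain ⟨B, hB⟩ := (G.kCircularMatroid k hk).exists_isBase
  rw [← hB.encard_compl_eq, kCircularMatroid_ground, ← hE.sdiff.cast_ncard_eq] at hs
  have hSE : G.vertexStar x ⊆ E(G) := fun e he ↦ he.edge_mem
  rw [← (hE.subset hSE).cast_ncard_eq, Nat.cast_le] at hs
  have h6 := Set.ncard_sdiff_add_ncard_of_subset hSE hE
  have hBE : B ⊆ E(G) := hB.subset_ground
  have h7 := Set.ncard_sdiff_add_ncard_of_subset hBE hE
  have h8 := Set.ncard_sdiff_singleton_add_one hx hV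
  have hB' := hB.isBasis_ground
  rw [kCircularMatroid_ground] at hB'
  obtain ⟨B, rfl⟩ := (hE.subset hBE).exists_finset_coe
  -- The rank is `|V| + k - 1`, so the corank bound reads `s(x) ≤ |E| - |V| - k + 1`.
  have h9 := Connects.card_add_one_of_isBasis hk (X := hE.toFinset) (I := B) (U := V(G))
    (by simpa using h3.connects_edgeSet) hV
    (by rw [← Set.ncard_eq_toFinset_card _ hE]; omega) (by simpa using hB')
  rw [Set.ncard_coe_finset] at h7
  omega

end Graph

/-! ### Recovering the vertex stars from the matroid -/

open Graph in
theorem mainTheorem3 {α α' β : Type*} (G : Graph α β) (G' : Graph α' β)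
    (hV : V(G).Finite) (hE : E(G).Finite) (hV' : V(G').Finite) (hE' : E(G').Finite)
    (k : ℕ) (hk : 1 ≤ k)
    (h3 : G.IsNConnected 3)
    (hC : (G.kCircuits k).Nonempty)
    (hs : ∀ x ∈ V(G), (G.vertexStar x).encard ≤ (G.kCircularMatroid k hk)✶.eRank)
    (hiso : ∀ x ∈ V(G'), (G'.vertexStar x).Nonempty)
    (hM : G'.kCircularMatroid k hk = G.kCircularMatroid k hk) :
    G.vertexStars = G'.vertexStars ∧ G.StronglyIsomorphic G' := by
  classical
  have hEE : E(G) = E(G') := by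
    rw [← kCircularMatroid_ground G k hk, ← hM, kCircularMatroid_ground]
  have hcount := fun x hx ↦ ncard_add_le_ncard_compl_vertexStar hV hE hk h3 hC hx (hs x hx)
  have hcyc : ∀ x ∈ V(G), ∀ f ∈ E(G) \ G.vertexStar x, f ∈ (G.kCircularMatroid k hk).closure
      ((E(G) \ G.vertexStar x) \ {f}) := by
    intro x hx f hf
    have hcon := h3.connects_compl_vertexStar hx hf
    have hc := hcount x hx
    obtain ⟨H, hH⟩ := (hE.sdiff (t := G.vertexStar x)).exists_finset_coe
    rw [← hH] at hf hcon hc ⊢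
    rw [Set.ncard_coe_finset] at hc
    refine mem_closure_of_connects hk ?_ hV.sdiff ?_ hc hf hcon
    · rw [hH]; exact Set.sdiff_subset
    · rintro v ⟨e, he, hv⟩
      rw [hH] at he
      exact ⟨hv.vertex_mem, by rintro rfl; exact he.2 hv⟩
  have hrank : ∀ (I X : Finset β), (G.kCircularMatroid k hk).IsBasis (I : Set β) X → X.Nonempty →
      (∀ f ∈ X, f ∈ (G.kCircularMatroid k hk).closure ((X : Set β) \ {f})) →
      I.card + 1 = (G.ends X).ncard + k ∧ I.card + 1 = (G'.ends X).ncard + k := by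
    intro I X hI hne hX
    exact ⟨G.card_add_one_of_isBasis_of_cyclic hk hI hne hX,
      G'.card_add_one_of_isBasis_of_cyclic hk (hM ▸ hI) hne (hM ▸ hX)⟩
  have hVnt : V(G).Nontrivial := by
    rw [← Set.one_lt_encard_iff_nontrivial]
    exact lt_trans (by norm_num) h3.1
  have hendsE : G.ends E(G) = V(G) := h3.connects_edgeSet.ends_eq hVnt
  have hendsE' : G'.ends E(G) = V(G') := by
    refine (G'.ends_subset_vertexSet _).antisymm fun v hv ↦ ?_
    obtain ⟨e, he⟩ := hiso v hv
    exact ⟨e, hEE ▸ Inc.edge_mem he, he⟩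
  have hn : V(G').ncard = V(G).ncard := by
    obtain ⟨B, hB⟩ := (G.kCircularMatroid k hk).exists_isBase
    have hBE : B ⊆ E(G) := hB.subset_ground
    have hB' := hB.isBasis_ground
    rw [kCircularMatroid_ground] at hB'
    obtain ⟨B, rfl⟩ := (hE.subset hBE).exists_finset_coe
    obtain ⟨X, hX⟩ := hE.exists_finset_coe
    rw [← hX] at hB'
    have hXne : X.Nonempty := by
      rw [← Finset.coe_nonempty, hX]
      obtain ⟨v, hv⟩ := hVnt.nonempty
      rw [← hendsE] at hv
      exact ⟨hv.choose, hv.choose_spec.1⟩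
    have := hrank B X hB' hXne fun f hf ↦ by
      have hfE : f ∈ E(G) := hX ▸ hf
      obtain ⟨a, b, hab⟩ := G.exists_isLink_of_mem_edgeSet hfE
      -- Any edge `f` avoids some vertex `x`; not being a coloop of `E(G) \ S(x, G)`, it is not one
      -- of `E(G)`.
      obtain ⟨x, hx, hxab⟩ := h3.exists_notMem (X := {a, b})
        ((encard_pair_le_two a b).trans (by norm_num))
      refine (G.kCircularMatroid k hk).closure_subset_closure ?_ (hcyc x hx f ⟨hfE, fun h ↦ ?_⟩)
      · rw [hX]; exact Set.sdiff_subset_sdiff_left Set.sdiff_subset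
      · exact hxab (Inc.eq_or_eq_of_isLink h hab)
    rw [hX, hendsE, hendsE'] at this
    omega
  have hstar : ∀ x ∈ V(G), ∃ x' ∈ V(G'), G'.vertexStar x' = G.vertexStar x := by
    intro x hx
    have hc := hcount x hx
    have hcy := hcyc x hx
    have hVx := Set.ncard_sdiff_singleton_add_one hx hV
    obtain ⟨H, hH⟩ := (hE.sdiff (t := G.vertexStar x)).exists_finset_coe
    have hHE : (H : Set β) ⊆ E(G) := hH ▸ Set.sdiff_subset
    have hHne : H.Nonempty := by
      rw [← Finset.card_pos, ← Set.ncard_coe_finset, hH]; omega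
    obtain ⟨I, hI⟩ := (G.kCircularMatroid k hk).exists_isBasis H hHE
    obtain ⟨I, rfl⟩ := (H.finite_toSet.subset hI.subset).exists_finset_coe
    rw [← hH] at hcy
    obtain ⟨h1, h2⟩ := hrank I H hI hHne hcy
    have hends : G.ends H = V(G) \ {x} := by
      obtain ⟨f, hf⟩ := hHne
      rw [← Finset.mem_coe, hH] at hf
      have hcon := h3.connects_compl_vertexStar hx hf
      have hnt : (V(G) \ {x}).Nontrivial := by
        obtain ⟨y, hy, hyx⟩ := h3.exists_notMem (X := {x}) (by simp)
        obtain ⟨z, hz, hzx⟩ := h3.exists_notMem (X := {x, y})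
          ((encard_pair_le_two x y).trans (by norm_num))
        simp only [Set.mem_insert_iff, not_or] at hzx
        exact ⟨y, ⟨hy, hyx⟩, z, ⟨hz, hzx.1⟩, fun h ↦ hzx.2 h.symm⟩
      rw [hH]
      refine (hcon.mono Set.sdiff_subset ?_).ends_eq hnt
      rintro v ⟨e, he, hv⟩
      exact ⟨hv.vertex_mem, by rintro rfl; exact he.2 hv⟩
    rw [hends] at h1
    -- By `h1` and `h2`, `H` covers `|V(G)| - 1` vertices in `G'` as well, one fewer than `G'` has.
    obtain ⟨x', hx', hx'H⟩ : ∃ x' ∈ V(G'), x' ∉ G'.ends H := by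
      by_contra! hcon
      have := Set.ncard_le_ncard hcon (G'.ends_finite H.finite_toSet)
      omega
    refine ⟨x', hx', Set.Subset.antisymm (fun e he ↦ ?_) fun e he ↦ ?_⟩
    · by_contra hex
      refine hx'H ⟨e, ?_, he⟩
      rw [hH]
      exact ⟨hEE ▸ Inc.edge_mem he, hex⟩
    · by_contra hex
      have heH : e ∉ H := fun h ↦ by
        rw [← Finset.mem_coe, hH] at h
        exact h.2 he
      have hIH : I ⊆ H := by exact_mod_cast hI.subset
      have hxI : x ∉ G.ends I := fun h ↦ by
        have := G.ends_mono hI.subset h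
        rw [hends] at this
        exact this.2 rfl
      -- In `G` the edge `e` brings the new vertex `x`. Read in `G'`, the enlarged independent set
      -- must cover more than `|V(G')| - 1` vertices, which is impossible if it misses `x'`.
      have hind := indep_insert_of_inc hk hI.indep he hxI
      rw [← hM, kCircularMatroid_indep_coe_iff] at hind
      have h4 := hind.2 _ subset_rfl
      rw [Finset.card_insert_of_notMem fun h ↦ heH (hIH h)] at h4
      have h5 : G'.ends (insert e I : Finset β) ⊆ V(G') \ {x'} := by
        rintro v ⟨g, hg, hv⟩
        refine ⟨hv.vertex_mem, ?_⟩
        rintro rfl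
        rw [Finset.coe_insert] at hg
        rcases hg with rfl | hg
        · exact hex hv
        · exact hx'H ⟨g, hIH hg, hv⟩
      have h6 := Set.ncard_le_ncard h5 hV'.sdiff
      have h7 := Set.ncard_sdiff_singleton_add_one hx' hV'
      omega
  choose φ hφV hφ using hstar
  let ψ : V(G) → V(G') := fun x ↦ ⟨φ x x.2, hφV x x.2⟩
  have hψ : ∀ x, G'.vertexStar (ψ x) = G.vertexStar x := fun x ↦ hφ x x.2
  have hinj : Function.Injective ψ := by
    intro x y hxy
    by_contra hne
    have hSxy : G.vertexStar x = G.vertexStar y := by rw [← hψ, ← hψ, hxy]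
    have hne' : (x : α) ≠ y := fun h ↦ hne (Subtype.ext h)
    obtain ⟨z, hz, hzxy⟩ := h3.exists_notMem (X := {(x : α), (y : α)})
      ((encard_pair_le_two _ _).trans (by norm_num))
    simp only [Set.mem_insert_iff, Set.mem_singleton_iff, not_or] at hzxy
    -- Connectivity of `G` without `y` gives an edge from `x` to a vertex other than `y`; it lies in
    -- the star of `x` but not in that of `y`.
    obtain ⟨e, a, rfl, b, hb, hab, -, hby⟩ := h3.exists_isLink_of_cut (X := {(y : α)})
      (W := {(x : α)}) (by simp) (by rw [Set.encard_singleton]; norm_num) x.2 hne' rfl hz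
      hzxy.2 hzxy.1
    have hey : e ∈ G.vertexStar y := hSxy ▸ hab.inc_left
    rcases Inc.eq_or_eq_of_isLink hey hab with h | h
    · exact hne' h.symm
    · exact hby h.symm
  have hbij : Function.Bijective ψ := by
    have := hV.to_subtype
    have := hV'.to_subtype
    have := Fintype.ofFinite V(G)
    have := Fintype.ofFinite V(G')
    rw [Fintype.bijective_iff_injective_and_card]
    refine ⟨hinj, ?_⟩
    rw [← Nat.card_eq_fintype_card, ← Nat.card_eq_fintype_card, Nat.card_coe_set_eq,
      Nat.card_coe_set_eq, hn]
  refine ⟨?_, stronglyIsomorphic_of_vertexStar hEE (Equiv.ofBijective ψ hbij) hψ⟩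
  ext S
  constructor
  · rintro ⟨x, hx, rfl⟩
    exact ⟨φ x hx, hφV x hx, hφ x hx⟩
  · rintro ⟨x', hx', rfl⟩
    obtain ⟨x, hx⟩ := hbij.2 ⟨x', hx'⟩
    exact ⟨x, x.2, by rw [← hψ, hx]⟩
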